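/- Theorem 1.4 (Muckenhoupt–Wheeden–Wolff characterization). Let $q\ge 2$ and let $T$ be the homogeneous tree in which every vertex has $q+1$ neighbours, except for a distinguished pre-root $o^*$, whose only neighbour is the root $o$; let $E$ be its set of edges and $\omega\in E$ the edge joining $o^*$ and $o$. Let $\partial T$ be the set of infinite geodesics starting at $o^*$, $\overline T=T\cup\partial T$, and for $x\in\overline T$ let $[o^*,x]\subset E$ be the set of edges of the geodesic from $o^*$ to $x$. For edges, $\beta\subseteq\alpha$ means that $\alpha$ lies on the geodesic from $o^*$ through $\beta$ (with $\beta=\alpha$ allowed). Put $S(\alpha)=\{x\in\overline T:\alpha\in[o^*,x]\}$ and $\partial T_\alpha=S(\alpha)\cap\partial T$, and for $x\in\partial T$ write $\beta\supset x$ if $\beta\in[o^*,x]$. Equip $\overline T$ with the topology generated by the sets $S(\alpha)$ and the singletons of vertices. Let $|\alpha|=q^{-d(\alpha)}$, where $d(\alpha)$ is the distance of $\alpha$ from $\omega$ (so $|\omega|=1$), and let $dx$ be the Borel measure on $\partial T$ with $\int_{\partial T_\alpha}dx=|\alpha|$ for all $\alpha\in E$. Let $1<p<\infty$, $p^*=p/(p-1)$,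 $0<s<1$, $\pi(\alpha)=|\alpha|^{(1-p^*s)/(1-p^*)}$, and let $\mu$ be a finite positive Borel measure on $\overline T$. Then each of the conditions (i), (ii) below is equivalent to the Hardy inequality: there is $C<\infty$ such that for all $\varphi:E\to[0,\infty)$ $$\int_{\overline T}\Big(\sum_{\alpha\in[o^*,x]}\varphi(\alpha)\Big)^p\,d\mu(x)\le C\sum_{\alpha\in E}\varphi(\alpha)^p\,\pi(\alpha).$$ (i) $\displaystyle\sup_{\alpha\in E}\ \mu(S(\alpha))^{-1}\int_{\partial T_\alpha}\Big(\sum_{\beta:\,x\subset\beta\subseteq\alpha}\frac{\mu(S(\beta))}{|\beta|^s}\Big)^{p^*}dx<\infty$; (ii) $\displaystyle\sup_{\alpha\in E}\ \mu(S(\alpha))^{-1}\int_{\partial T_\alpha}\Big(\sup_{\beta:\,x\subset\beta\subseteq\alpha}\frac{\mu(S(\beta))}{|\beta|^s}\Big)^{p^*}dx<\infty$. Here edges $\alpha$ with $\mu(S(\alpha))=0$, for which the integrals vanish, contribute $0$ to the suprema over $\alpha$. -/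

import Mathlib

open MeasureTheory
open scoped ENNReal NNReal

noncomputable section

namespace HardyTree

/-- The edges of the rooted homogeneous tree `T` in which every vertex other than the pre-root
has `q + 1` neighbours. The vertices different from the pre-root `o*` are the finite words over
`{0, …, q-1}`: the root `o` is the empty word, the children of `w` are the words `w ++ [i]`, and
`o*` is joined to `o` only. An edge `α` is encoded by the word of its endpoint `e(α)` that is
further away from `o*` (every vertex other than `o*` is `e(α)` for exactly one edge). The root
edge `ω`, joining `o*` and `o`, is therefore the empty word. -/
abbrev Edge (q : ℕ) : Type := List (Fin q)

/-- The boundary `∂T`: the infinite geodesics starting at `o*`, i.e. the infinite words; the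
geodesic `x` runs through `o*`, `[]`, `[x 0]`, `[x 0, x 1]`, … -/
abbrev Boundary (q : ℕ) : Type := ℕ → Fin q

/-- The standard compactification `T ∪ ∂T` of the tree. -/
inductive TBar (q : ℕ) : Type
  | preroot : TBar q
  | vertex (w : List (Fin q)) : TBar q
  | bdry (x : Boundary q) : TBar q

variable {q : ℕ}

/-- `∂S(α)`, which is also the boundary `∂T_α` of the subtree `T_α` with root edge `α`: the set of
the infinite geodesics from `o*` that pass through `α`. -/
def bdryS (α : Edge q) : Set (Boundary q) := {x | ∀ i : Fin α.length, x i = α.get i}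

/-- `[o*, x]`: the set of edges of the geodesic joining `o*` to `x`. -/
def path : TBar q → Set (Edge q)
  | .preroot => ∅
  | .vertex w => {α | α <+: w}
  | .bdry x => {α | x ∈ bdryS α}

/-- The successor set `S(α) = {x ∈ T ∪ ∂T : α ∈ [o*, x]}`. -/
def S (α : Edge q) : Set (TBar q) := {x | α ∈ path x}

/-- The order on edges, `α ⊆ β`: the edge `β` lies on the geodesic from `o*` to `e(α)`. -/
def Below (α β : Edge q) : Prop := β ∈ path (.vertex α)

/-- The topology of `T ∪ ∂T` generated by the successor sets and the singletons of vertices. -/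
instance : TopologicalSpace (TBar q) :=
  TopologicalSpace.generateFrom
    (Set.range S ∪ Set.range (fun w : List (Fin q) => {TBar.vertex w}) ∪ {{TBar.preroot}})

instance : MeasurableSpace (TBar q) := borel (TBar q)

instance : BorelSpace (TBar q) := ⟨rfl⟩

/-- The canonical weight `|α| = q ^ (-d(α))`, where `d(α)` is the distance of `α` from `ω`. -/
def size (α : Edge q) : ℝ≥0 := ((q : ℝ≥0) ^ α.length)⁻¹

/-- The Lebesgue measure `dx` on `∂T`: all the digits are independent and uniformly
distributed. See `lebesgue_bdryS` for its defining property. -/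
def lebesgue (q : ℕ) [NeZero q] : Measure (Boundary q) :=
  Measure.infinitePi fun _ : ℕ => ProbabilityTheory.uniformOn (Set.univ : Set (Fin q))

/-- The Lebesgue measure of `∂S(α)` is `|α|`. -/
theorem lebesgue_bdryS [NeZero q] (α : Edge q) : lebesgue q (bdryS α) = size α := by
  classical
  have h : bdryS α = Set.pi (Finset.range α.length : Set ℕ)
      (fun n => {a : Fin q | ∀ h : n < α.length, a = α.get ⟨n, h⟩}) := by
    ext x
    simp only [bdryS, Set.mem_ofPred_eq, Set.mem_pi, Finset.coe_range, Set.mem_Iio]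
    exact ⟨fun H n hn h => H ⟨n, h⟩, fun H i => H i i.2 i.2⟩
  rw [h, lebesgue, Measure.infinitePi_pi _ (fun _ _ => MeasurableSet.of_discrete)]
  have h2 : ∀ n ∈ Finset.range α.length,
      ProbabilityTheory.uniformOn (Set.univ : Set (Fin q))
        {a : Fin q | ∀ h : n < α.length, a = α.get ⟨n, h⟩} = (q : ℝ≥0∞)⁻¹ := by
    intro n hn
    have hn := Finset.mem_range.1 hn
    have : {a : Fin q | ∀ h : n < α.length, a = α.get ⟨n, h⟩} = {α.get ⟨n, hn⟩} := by
      ext a; simp [hn]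
    rw [this, ProbabilityTheory.uniformOn_univ]
    simp
  rw [Finset.prod_congr rfl h2]
  have hq : (q : ℝ≥0) ≠ 0 := by exact_mod_cast NeZero.ne q
  simp [size, hq, ENNReal.inv_pow]

/-- The Hardy operator `Iφ(x) = ∑_{α ∈ [o*, x]} φ(α)` for a nonnegative edge function `φ`; the sum
is `∞` where it diverges. -/
def hardyOp (φ : Edge q → ℝ≥0) (x : TBar q) : ℝ≥0∞ := ∑' α : path x, (φ α : ℝ≥0∞)

/-- The two-weight Hardy inequality for the edge weight `π` and the measure `μ`: there is a
finite constant `C` such that `∫ (Iφ)^p dμ ≤ C ∑_α φ(α)^p π(α)` for all `φ : E → ℝ₊`. -/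
def HardyInequality (p : ℝ) (π : Edge q → ℝ≥0) (μ : Measure (TBar q)) : Prop :=
  ∃ C : ℝ≥0, ∀ φ : Edge q → ℝ≥0,
    ∫⁻ x, hardyOp φ x ^ p ∂μ ≤ C * ∑' α : Edge q, ((φ α ^ p * π α : ℝ≥0) : ℝ≥0∞)

/-- The edges `β` of the subtree `T_α` (i.e. `β ⊆ α`) with `β ⊃ x`, for a boundary point `x`. -/
def edgesBetween (α : Edge q) (x : Boundary q) : Set (Edge q) :=
  {β | Below β α ∧ x ∈ bdryS β}

/-- The edge weight `π(α) = |α| ^ ((1 - p* s) / (1 - p*))`, where `p* = p / (p - 1)`. -/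
def weight (p s : ℝ) (α : Edge q) : ℝ≥0 :=
  size α ^ ((1 - p.conjExponent * s) / (1 - p.conjExponent))

/-- Testing condition with sums:
`sup_α μ(S(α))⁻¹ ∫_{∂T_α} (∑_{x ∈ β ⊆ α} μ(S(β)) / |β|^s)^r dx < ∞`. If `μ(S(α)) = 0`, then the
integral is `0` as well, and the corresponding term is `0` by the convention `∞ * 0 = 0`. -/
def SumTesting [NeZero q] (r s : ℝ) (μ : Measure (TBar q)) : Prop :=
  (⨆ α : Edge q, (μ (S α))⁻¹ *
    (∫⁻ x in bdryS α,
      (∑' β : edgesBetween α x, μ (S (β : Edge q)) / ((size (β : Edge q) ^ s : ℝ≥0) : ℝ≥0∞)) ^ r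
        ∂(lebesgue q))) < ∞

/-- Testing condition with suprema:
`sup_α μ(S(α))⁻¹ ∫_{∂T_α} (sup_{x ∈ β ⊆ α} μ(S(β)) / |β|^s)^r dx < ∞`. -/
def SupTesting [NeZero q] (r s : ℝ) (μ : Measure (TBar q)) : Prop :=
  (⨆ α : Edge q, (μ (S α))⁻¹ *
    (∫⁻ x in bdryS α,
      (⨆ β : edgesBetween α x, μ (S (β : Edge q)) / ((size (β : Edge q) ^ s : ℝ≥0) : ℝ≥0∞)) ^ r
        ∂(lebesgue q))) < ∞

end HardyTree

end

/-!
Write `r = p*`, `M(α) = μ(S(α))` and `a(α) = M(α) / |α|^s`. The proof runs through a third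
condition, testing over subtrees (`SubtreeTesting`): `∑_{β ⊆ α} M(β)^r π(β)^(1-r) ≤ C M(α)` for
all `α`. For the weight `π` of the theorem, the left side equals
`∫_{∂T_α} ∑_{x ∈ β ⊆ α} a(β)^r dx` (`belowSum_weight_eq`). Hence condition (i) implies testing over
subtrees, which implies condition (ii), because a supremum is at most an `ℓ^r` norm and an `ℓ^r`
norm is at most a sum.

Two implications of substance remain, besides the necessity of testing, which follows by inserting
`φ = M^(r-1) π^(1-r)` on finite parts of a subtree (`HardyInequality.subtreeTesting`). Both rest on
the inequality `(Iφ)^t ≤ t I(φ (Iφ)^(t-1))` (`pathSum_rpow_le`), on the duality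
`∫ Iφ dν = ∑_α φ(α) ν(S(α))`, and on summation by parts: a power of `Iφ` is again a sum along
geodesics, of its increments `D ≥ 0`, so `∑_α σ(α) Iφ(α)^t = ∑_β D(β) ∑_{α ⊆ β} σ(α)`.

* Testing over subtrees implies the Hardy inequality (`SubtreeTesting.hardyInequality`). Integrate
  the first inequality with `t = p` and apply Hölder's inequality with the weight `π`. The second
  factor contains `∑_α M(α)^r π(α)^(1-r) Iφ(α)^p`, which by parts and by testing is at most
  `C ∑_β D(β) M(β) = C ∫ (Iφ)^p dμ`; it is absorbed on the left.
* Condition (ii) implies condition (i) (`SupTesting.sumTesting`). Since `M` is additive and `s < 1`,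
  `∑_{α ⊆ β} a(α) |α| ≤ c a(β) |β|` (`belowSum_density_le`). With `φ` the restriction of `a` to a
  subtree, Lebesgue measure in place of `μ`, and `t = r`, the same argument gives
  `∫ (Iφ)^r dx ≤ r c ∫ (sup a) (Iφ)^(r-1) dx`, and Hölder's inequality and absorption finish the
  proof (`lintegral_pathSum_le_pathSup`); this is Garsia's inequality for increasing processes.

Absorption needs finite integrals, so edge functions are cut off to finite sets of edges; monotone
convergence removes the cut-off (`lintegral_pathSum_rpow_le_of_finset`).
-/

open MeasureTheory
open scoped ENNReal NNReal
noncomputable section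
namespace HardyTree
variable {q : ℕ}

/-! ### Sums and suprema along geodesics -/

/-- The sum of an extended nonnegative edge function over the geodesic `[o*, x]`. For finite edge
functions this is `hardyOp`; the values `∞` are allowed because increments of powers and weights
are also summed along geodesics. -/
def pathSum (F : Edge q → ℝ≥0∞) (x : TBar q) : ℝ≥0∞ := ∑' α : path x, F α

/-- The supremum of an edge function over the geodesic `[o*, x]`. -/
def pathSup (F : Edge q → ℝ≥0∞) (x : TBar q) : ℝ≥0∞ := ⨆ α : path x, F α

/-- The sum of an edge function over the subtree of the edges `α ⊆ β`. -/
def belowSum (F : Edge q → ℝ≥0∞) (β : Edge q) : ℝ≥0∞ := ∑' α : {α | Below α β}, F α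

lemma measurableSet_S (α : Edge q) : MeasurableSet (S α) :=
  (TopologicalSpace.isOpen_generateFrom_of_mem (Or.inl (Or.inl ⟨α, rfl⟩))).measurableSet

lemma pathSum_eq_tsum_indicator (F : Edge q → ℝ≥0∞) (x : TBar q) :
    pathSum F x = ∑' α, (S α).indicator (fun _ => F α) x := by
  rw [pathSum, tsum_subtype (path x) F]
  rfl

lemma pathSup_eq_iSup_indicator (F : Edge q → ℝ≥0∞) (x : TBar q) :
    pathSup F x = ⨆ α, (S α).indicator (fun _ => F α) x := by
  rw [pathSup, iSup_subtype]
  refine iSup_congr fun α => ?_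
  by_cases h : α ∈ path x
  · rw [Set.indicator_of_mem (show x ∈ S α from h)]
    simp [h]
  · rw [Set.indicator_of_notMem (show x ∉ S α from h)]
    simp [h]

lemma measurable_pathSum (F : Edge q → ℝ≥0∞) : Measurable (pathSum F) := by
  simp_rw [funext (pathSum_eq_tsum_indicator F)]
  exact Measurable.tsum fun α =>
    measurable_const.indicator (measurableSet_S α)

lemma measurable_pathSup (F : Edge q → ℝ≥0∞) : Measurable (pathSup F) := by
  simp_rw [funext (pathSup_eq_iSup_indicator F)]
  exact Measurable.iSup fun α => measurable_const.indicator (measurableSet_S α)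

/-- Summation over the tree is dual to integration over its compactification. -/
lemma lintegral_pathSum (F : Edge q → ℝ≥0∞) (ν : Measure (TBar q)) :
    ∫⁻ x, pathSum F x ∂ν = ∑' α, F α * ν (S α) := by
  simp_rw [pathSum_eq_tsum_indicator]
  rw [lintegral_tsum fun α => (measurable_const.indicator (measurableSet_S α)).aemeasurable]
  exact tsum_congr fun α => lintegral_indicator_const (measurableSet_S α) _

lemma pathSum_mono {F G : Edge q → ℝ≥0∞} {x : TBar q} (h : ∀ α ∈ path x, F α ≤ G α) :
    pathSum F x ≤ pathSum G x :=
  ENNReal.tsum_le_tsum fun α => h α α.2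

lemma pathSum_const_mul (c : ℝ≥0∞) (F : Edge q → ℝ≥0∞) (x : TBar q) :
    pathSum (fun α => c * F α) x = c * pathSum F x :=
  ENNReal.tsum_mul_left

lemma le_pathSum (F : Edge q → ℝ≥0∞) {x : TBar q} {α : Edge q} (h : α ∈ path x) :
    F α ≤ pathSum F x :=
  ENNReal.le_tsum (f := fun β : path x => F β) ⟨α, h⟩

lemma le_pathSup (F : Edge q → ℝ≥0∞) {x : TBar q} {α : Edge q} (h : α ∈ path x) :
    F α ≤ pathSup F x :=
  le_iSup (fun β : path x => F β) ⟨α, h⟩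

lemma pathSum_le_tsum (F : Edge q → ℝ≥0∞) (x : TBar q) : pathSum F x ≤ ∑' α, F α :=
  ENNReal.tsum_comp_le_tsum_of_injective Subtype.val_injective F

lemma pathSum_preroot (F : Edge q → ℝ≥0∞) : pathSum F .preroot = 0 := by
  simp [pathSum_eq_tsum_indicator, S, path]

lemma pathSum_vertex_nil (F : Edge q → ℝ≥0∞) : pathSum F (.vertex []) = F [] := by
  have h : path (.vertex ([] : List (Fin q))) = {[]} := by
    ext α; simp [path]
  rw [pathSum, h]
  exact tsum_singleton [] F

lemma pathSum_vertex_concat (F : Edge q → ℝ≥0∞) (w : List (Fin q)) (i : Fin q) :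
    pathSum F (.vertex (w ++ [i])) = pathSum F (.vertex w) + F (w ++ [i]) := by
  have h : path (.vertex (w ++ [i])) = path (.vertex w) ∪ {w ++ [i]} := by
    ext α; simp [path, List.prefix_concat_iff, or_comm]
  have hd : Disjoint (path (.vertex w)) {w ++ [i]} := by
    rw [Set.disjoint_singleton_right]
    intro (hw : w ++ [i] <+: w)
    simpa using hw.length_le
  rw [pathSum, h, ENNReal.summable.tsum_union_disjoint hd ENNReal.summable, tsum_singleton]
  rfl

lemma mem_bdryS_iff {α : Edge q} {x : Boundary q} :
    x ∈ bdryS α ↔ α = List.ofFn fun i : Fin α.length => x i := by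
  rw [List.ext_get_iff]
  simp only [bdryS, Set.mem_ofPred_eq, List.length_ofFn, List.get_ofFn, true_and]
  exact ⟨fun h n h1 h2 => (h ⟨n, h1⟩).symm, fun h i => (h i i.2 (by simp)).symm⟩

/-- A geodesic contains at most one edge at each distance from the root edge. -/
lemma eq_of_mem_path {x : TBar q} {α β : Edge q} (hα : α ∈ path x) (hβ : β ∈ path x)
    (h : α.length = β.length) : α = β := by
  cases x with
  | preroot => exact hα.elim
  | vertex w =>
    exact (List.prefix_of_prefix_length_le hα hβ h.le).eq_of_length h
  | bdry x =>
    rw [mem_bdryS_iff.1 hα, mem_bdryS_iff.1 hβ, h]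

/-- A geodesic that passes through an edge of the subtree below `α` passes through `α`. -/
lemma mem_path_of_below {x : TBar q} {α β : Edge q} (h : Below β α) (hβ : β ∈ path x) :
    α ∈ path x := by
  cases x with
  | preroot => exact hβ.elim
  | vertex w => exact List.IsPrefix.trans h hβ
  | bdry x =>
    intro i
    have hle : α.length ≤ β.length := List.IsPrefix.length_le h
    rw [hβ ⟨i, i.2.trans_le hle⟩]
    exact (List.IsPrefix.getElem h i.2).symm

/-- The sum along an infinite geodesic is the supremum of the sums along its initial segments. -/
lemma pathSum_bdry (F : Edge q → ℝ≥0∞) (x : Boundary q) :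
    pathSum F (.bdry x) = ⨆ n : ℕ, pathSum F (.vertex (List.ofFn fun i : Fin n => x i)) := by
  have hr : path (.bdry x) = Set.range fun n : ℕ => List.ofFn fun i : Fin n => x i := by
    ext α
    refine ⟨fun h => ⟨α.length, (mem_bdryS_iff.1 h).symm⟩, ?_⟩
    rintro ⟨n, rfl⟩
    simp [path, bdryS]
  have hinj : Function.Injective fun n : ℕ => List.ofFn fun i : Fin n => x i := fun m n h => by
    simpa using congrArg List.length h
  have hsum (n : ℕ) : pathSum F (.vertex (List.ofFn fun i : Fin n => x i)) =
      ∑ k ∈ Finset.range (n + 1), F (List.ofFn fun i : Fin k => x i) := by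
    induction n with
    | zero => simp [pathSum_vertex_nil]
    | succ n ih =>
      rw [Finset.sum_range_succ, ← ih, List.ofFn_succ_last]
      exact pathSum_vertex_concat F _ _
  simp_rw [hsum]
  rw [pathSum, hr, tsum_range F hinj, ENNReal.tsum_eq_iSup_nat' (Filter.tendsto_add_atTop_nat 1)]

/-- A bound for sums along finite geodesics extends to all geodesics. -/
lemma pathSum_le_of_vertex {F G : Edge q → ℝ≥0∞} {f : ℝ≥0∞ → ℝ≥0∞}
    (hf : ∀ g : ℕ → ℝ≥0∞, f (⨆ n, g n) ≤ ⨆ n, f (g n)) (hf0 : f 0 = 0)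
    (h : ∀ w, f (pathSum F (.vertex w)) ≤ pathSum G (.vertex w)) (x : TBar q) :
    f (pathSum F x) ≤ pathSum G x := by
  cases x with
  | preroot => simp [pathSum_preroot, hf0]
  | vertex w => exact h w
  | bdry x =>
    rw [pathSum_bdry, pathSum_bdry]
    exact (hf _).trans (iSup_mono fun n => h _)

lemma iSup_rpow {ι : Sort*} {t : ℝ} (ht : 0 < t) (g : ι → ℝ≥0∞) :
    (⨆ n, g n) ^ t = ⨆ n, g n ^ t :=
  (ENNReal.orderIsoRpow t ht).map_iSup g

/-! ### Powers of path sums -/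

/-- The tangent line inequality for `X ↦ X ^ t` at `X = A + a`. -/
lemma add_rpow_le_rpow_add_mul {t : ℝ} (ht : 1 ≤ t) (A a : ℝ≥0∞) :
    (A + a) ^ t ≤ A ^ t + ENNReal.ofReal t * (a * (A + a) ^ (t - 1)) := by
  have ht0 : 0 < t := by linarith
  have htt : ENNReal.ofReal t ≠ 0 := by simpa using ht0
  rcases eq_or_ne A ∞ with rfl | hA
  · simp [ENNReal.top_rpow_of_pos ht0]
  rcases eq_or_ne a ∞ with rfl | ha
  · have h0 : (∞ : ℝ≥0∞) ^ (t - 1) ≠ 0 := by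
      rcases ht.eq_or_lt with h | h
      · simp [← h]
      · simp [ENNReal.top_rpow_of_pos (sub_pos.2 h)]
    simp [ENNReal.top_mul h0, ENNReal.mul_top htt]
  lift A to ℝ≥0 using hA
  lift a to ℝ≥0 using ha
  have key : ((A : ℝ) + a) ^ t ≤ A ^ t + t * (a * (A + a) ^ (t - 1)) := by
    rcases eq_or_lt_of_le (add_nonneg A.coe_nonneg a.coe_nonneg : (0 : ℝ) ≤ A + a) with h | h
    · have h1 : (A : ℝ) + a = 0 := h.symm
      rw [h1, Real.zero_rpow ht0.ne']
      exact add_nonneg (Real.rpow_nonneg A.coe_nonneg _)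
        (mul_nonneg ht0.le (mul_nonneg a.coe_nonneg (Real.rpow_nonneg le_rfl _)))
    · change 0 < (A : ℝ) + a at h
      have hb := one_add_mul_self_le_rpow_one_add (s := (-(a / (A + a)) : ℝ))
        (neg_le_neg ((div_le_one h).2 (by simp))) ht
      have h1 : 1 + -(a / (A + a) : ℝ) = A / (A + a) := by field_simp; ring
      rw [h1, Real.div_rpow A.coe_nonneg h.le] at hb
      have hX := Real.rpow_pos_of_pos h t
      rw [le_div_iff₀ hX] at hb
      rw [Real.rpow_sub_one h.ne']
      have : (1 + t * -(a / (A + a) : ℝ)) * ((A : ℝ) + a) ^ t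
          = (A + a : ℝ) ^ t - t * (a * ((A + a : ℝ) ^ t / (A + a))) := by ring
      linarith
  have h2 : (0 : ℝ) ≤ t - 1 := by linarith
  rw [← ENNReal.coe_add, ← ENNReal.coe_rpow_of_nonneg _ ht0.le,
    ← ENNReal.coe_rpow_of_nonneg _ ht0.le, ← ENNReal.coe_rpow_of_nonneg _ h2, ENNReal.ofReal, ← ENNReal.coe_mul, ← ENNReal.coe_mul,
    ← ENNReal.coe_add, ENNReal.coe_le_coe, ← NNReal.coe_le_coe]
  push_cast
  rw [Real.coe_toNNReal t ht0.le]
  exact key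

lemma pathSum_rpow_le {t : ℝ} (ht : 1 ≤ t) (F : Edge q → ℝ≥0∞) (x : TBar q) :
    pathSum F x ^ t ≤
      ENNReal.ofReal t * pathSum (fun α => F α * pathSum F (.vertex α) ^ (t - 1)) x := by
  have ht0 : 0 < t := by linarith
  rw [← pathSum_const_mul]
  refine pathSum_le_of_vertex (f := (· ^ t)) (fun g => (iSup_rpow ht0 g).le)
    (ENNReal.zero_rpow_of_pos ht0) (fun w => ?_) x
  induction w using List.reverseRecOn with
  | nil =>
    have := add_rpow_le_rpow_add_mul ht 0 (F [])
    simpa [pathSum_vertex_nil, ENNReal.zero_rpow_of_pos ht0] using this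
  | append_singleton w i ih =>
    rw [pathSum_vertex_concat _ w i]
    refine (add_rpow_le_rpow_add_mul ht _ _).trans ?_
    rw [pathSum_vertex_concat (fun α => _ * (F α * _)), pathSum_vertex_concat F]
    gcongr

/-- The increment at the edge `α` of the `t`-th power of the sums of `F` along geodesics. -/
def increment (F : Edge q → ℝ≥0∞) (t : ℝ) (α : Edge q) : ℝ≥0∞ :=
  pathSum F (.vertex α) ^ t - if α = [] then 0 else pathSum F (.vertex α.dropLast) ^ t

lemma pathSum_increment_vertex (F : Edge q → ℝ≥0∞) {t : ℝ} (ht : 0 < t) (w : List (Fin q)) :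
    pathSum (increment F t) (.vertex w) = pathSum F (.vertex w) ^ t := by
  induction w using List.reverseRecOn with
  | nil => simp [pathSum_vertex_nil, increment]
  | append_singleton w i ih =>
    rw [pathSum_vertex_concat, ih, increment, List.dropLast_concat]
    simp only [List.append_eq_nil_iff, List.cons_ne_self, and_false, if_false]
    refine add_tsub_cancel_of_le (ENNReal.rpow_le_rpow ?_ ht.le)
    rw [pathSum_vertex_concat]
    exact le_self_add

lemma pathSum_increment (F : Edge q → ℝ≥0∞) {t : ℝ} (ht : 0 < t) (x : TBar q) :
    pathSum (increment F t) x = pathSum F x ^ t := by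
  cases x with
  | preroot => simp [pathSum_preroot, ht]
  | vertex w => exact pathSum_increment_vertex F ht w
  | bdry x =>
    rw [pathSum_bdry, pathSum_bdry, iSup_rpow ht]
    exact iSup_congr fun n => pathSum_increment_vertex F ht _

/-- Summation by parts on the tree. -/
lemma tsum_mul_pathSum (σ D : Edge q → ℝ≥0∞) :
    ∑' α, σ α * pathSum D (.vertex α) = ∑' β, D β * belowSum σ β := by
  have h1 (α : Edge q) : σ α * pathSum D (.vertex α) =
      ∑' β, {α | Below α β}.indicator (fun α => D β * σ α) α := by
    rw [pathSum_eq_tsum_indicator, ← ENNReal.tsum_mul_left]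
    refine tsum_congr fun β => ?_
    by_cases h : Below α β
    · rw [Set.indicator_of_mem (show TBar.vertex α ∈ S β from h),
        Set.indicator_of_mem (show α ∈ {α | Below α β} from h), mul_comm]
    · rw [Set.indicator_of_notMem (show TBar.vertex α ∉ S β from h),
        Set.indicator_of_notMem (show α ∉ {α | Below α β} from h), mul_zero]
  simp_rw [h1]
  rw [ENNReal.tsum_comm]
  refine tsum_congr fun β => ?_
  rw [← tsum_subtype, ENNReal.tsum_mul_left]
  rfl

/-! ### Two facts about Hölder's inequality -/

lemma tsum_mul_le_Lp_mul_Lq {ι : Type*} (f g : ι → ℝ≥0∞) {p r : ℝ} (h : p.HolderConjugate r) :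
    ∑' i, f i * g i ≤ (∑' i, f i ^ p) ^ (1 / p) * (∑' i, g i ^ r) ^ (1 / r) := by
  rw [ENNReal.tsum_eq_iSup_sum]
  refine iSup_le fun s => (ENNReal.inner_le_Lp_mul_Lq s f g h).trans ?_
  gcongr
  · exact h.one_div_nonneg
  · exact ENNReal.sum_le_tsum s
  · exact h.symm.one_div_nonneg
  · exact ENNReal.sum_le_tsum s

/-- Absorption of a finite quantity that occurs to a power less than one on the right. -/
lemma le_of_le_rpow_mul_rpow {p r : ℝ} (h : p.HolderConjugate r) {X Y k : ℝ≥0∞} (hX : X ≠ ∞)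
    (hle : X ≤ k * Y ^ (1 / p) * X ^ (1 / r)) : X ≤ k ^ p * Y := by
  rcases eq_or_ne X 0 with rfl | h0
  · exact zero_le
  have hsplit : X = X ^ (1 / p) * X ^ (1 / r) := by
    rw [← ENNReal.rpow_add _ _ h0 hX]
    have := h.inv_add_inv_eq_one
    simp only [one_div, this, ENNReal.rpow_one]
  have hc0 : X ^ (1 / r) ≠ 0 := by simp [ENNReal.rpow_eq_zero_iff, h0, hX]
  have hc1 : X ^ (1 / r) ≠ ∞ := ENNReal.rpow_ne_top_of_nonneg h.symm.one_div_nonneg hX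
  have h1 : X ^ (1 / p) ≤ k * Y ^ (1 / p) := by
    rw [← ENNReal.mul_le_mul_iff_left hc0 hc1, ← hsplit]
    exact hle
  have h2 := ENNReal.rpow_le_rpow h1 h.nonneg
  rwa [ENNReal.mul_rpow_of_nonneg _ _ h.nonneg, ← ENNReal.rpow_mul, ← ENNReal.rpow_mul,
    one_div_mul_cancel h.ne_zero, ENNReal.rpow_one, ENNReal.rpow_one] at h2

/-! ### Reduction to edge functions of finite support -/

lemma lintegral_pathSum_rpow_le_of_finset (F : Edge q → ℝ≥0∞) {t : ℝ} (ht : 0 < t)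
    (ν : Measure (TBar q)) {B : ℝ≥0∞}
    (h : ∀ s : Finset (Edge q), ∫⁻ x, pathSum ((s : Set (Edge q)).indicator F) x ^ t ∂ν ≤ B) :
    ∫⁻ x, pathSum F x ^ t ∂ν ≤ B := by
  have hmono : Monotone fun (s : Finset (Edge q)) x =>
      pathSum ((s : Set (Edge q)).indicator F) x ^ t := fun s s' hs x =>
    ENNReal.rpow_le_rpow (pathSum_mono fun α _ =>
      Set.indicator_le_indicator_of_subset (Finset.coe_subset.2 hs) (fun _ => zero_le) α) ht.le
  have hsup (x : TBar q) : pathSum F x ^ t =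
      ⨆ s : Finset (Edge q), pathSum ((s : Set (Edge q)).indicator F) x ^ t := by
    rw [← iSup_rpow ht]
    refine congrArg (· ^ t) (le_antisymm ?_ (iSup_le fun s => pathSum_mono fun α _ =>
      Set.indicator_le_self' (fun _ _ => zero_le) α))
    rw [pathSum_eq_tsum_indicator, ENNReal.tsum_eq_iSup_sum]
    refine iSup_mono fun s => ?_
    rw [pathSum_eq_tsum_indicator]
    refine le_trans (Finset.sum_le_sum fun α hα => ?_) (ENNReal.sum_le_tsum s)
    rw [Set.indicator_of_mem (s := (s : Set (Edge q))) (by exact_mod_cast hα)]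
  simp_rw [hsup]
  rw [lintegral_iSup_directed (fun s => ((measurable_pathSum _).pow_const t).aemeasurable)
    hmono.directed_le]
  exact iSup_le h

lemma tsum_finset_indicator_ne_top (s : Finset (Edge q)) {F : Edge q → ℝ≥0∞}
    (hF : ∀ α, F α ≠ ∞) : ∑' α, (s : Set (Edge q)).indicator F α ≠ ∞ := by
  rw [← tsum_subtype, Finset.tsum_subtype']
  exact ENNReal.sum_ne_top.2 fun α _ => hF α

lemma lintegral_pathSum_rpow_ne_top {F : Edge q → ℝ≥0∞} (hF : ∑' α, F α ≠ ∞) {t : ℝ}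
    (ht : 0 ≤ t) (ν : Measure (TBar q)) [IsFiniteMeasure ν] :
    ∫⁻ x, pathSum F x ^ t ∂ν ≠ ∞ := by
  refine ne_top_of_le_ne_top (b := ∫⁻ _, (∑' α, F α) ^ t ∂ν) ?_
    (lintegral_mono fun x => ENNReal.rpow_le_rpow (pathSum_le_tsum F x) ht)
  rw [lintegral_const]
  exact ENNReal.mul_ne_top (ENNReal.rpow_ne_top_of_nonneg ht hF) (measure_ne_top _ _)

/-! ### The Hardy inequality and testing over subtrees -/

/-- Integrated form of `pathSum_rpow_le`. -/
lemma lintegral_pathSum_rpow_le {t : ℝ} (ht : 1 ≤ t) (F : Edge q → ℝ≥0∞) (ν : Measure (TBar q)) :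
    ∫⁻ x, pathSum F x ^ t ∂ν ≤
      ENNReal.ofReal t * ∑' α, F α * pathSum F (.vertex α) ^ (t - 1) * ν (S α) := by
  rw [← lintegral_pathSum, ← lintegral_const_mul _ (measurable_pathSum _)]
  exact lintegral_mono fun x => pathSum_rpow_le ht F x

/-- Testing over subtrees:
`∑_{β ⊆ α} μ(S(β))^r π(β)^(1-r) ≤ C μ(S(α))` for all edges `α`. It lies between the two testing
conditions of the theorem and is equivalent to the Hardy inequality for every positive edge
weight `π`. -/
def SubtreeTesting (r : ℝ) (π : Edge q → ℝ≥0) (μ : Measure (TBar q)) : Prop :=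
  ∃ C : ℝ≥0, ∀ α : Edge q,
    belowSum (fun β => μ (S β) ^ r * (π β : ℝ≥0∞) ^ (1 - r)) α ≤ C * μ (S α)

/-- A Carleson embedding: the powers of path sums increase along geodesics, so summation by parts
applied to their increments reduces the bound to testing over subtrees. -/
lemma tsum_mul_pathSum_rpow_le {t r : ℝ} (ht : 0 < t) {π : Edge q → ℝ≥0} {μ : Measure (TBar q)}
    {C : ℝ≥0} (hC : ∀ α : Edge q,
      belowSum (fun β => μ (S β) ^ r * (π β : ℝ≥0∞) ^ (1 - r)) α ≤ C * μ (S α))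
    (F : Edge q → ℝ≥0∞) :
    ∑' α, μ (S α) ^ r * (π α : ℝ≥0∞) ^ (1 - r) * pathSum F (.vertex α) ^ t ≤
      C * ∫⁻ x, pathSum F x ^ t ∂μ := by
  simp_rw [← pathSum_increment F ht]
  rw [tsum_mul_pathSum, lintegral_pathSum, ← ENNReal.tsum_mul_left]
  refine ENNReal.tsum_le_tsum fun β => ?_
  rw [mul_left_comm]
  gcongr
  exact hC β

lemma lintegral_pathSum_rpow_le_of_subtreeTesting {p r : ℝ} (h : p.HolderConjugate r)
    {π : Edge q → ℝ≥0} (hπ : ∀ α, π α ≠ 0) {μ : Measure (TBar q)} [IsFiniteMeasure μ] {C : ℝ≥0}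
    (hC : ∀ α : Edge q,
      belowSum (fun β => μ (S β) ^ r * (π β : ℝ≥0∞) ^ (1 - r)) α ≤ C * μ (S α))
    {F : Edge q → ℝ≥0∞} (hF : ∑' α, F α ≠ ∞) :
    ∫⁻ x, pathSum F x ^ p ∂μ ≤
      (ENNReal.ofReal p * (C : ℝ≥0∞) ^ (1 / r)) ^ p * ∑' α, F α ^ p * π α := by
  refine le_of_le_rpow_mul_rpow h (lintegral_pathSum_rpow_ne_top hF h.nonneg μ) ?_
  have hp1 : 0 ≤ p - 1 := h.sub_one_pos.le
  have hexp : -(1 / p) * r = 1 - r := by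
    have := h.symm.div_conj_eq_sub_one
    linear_combination -this
  calc ∫⁻ x, pathSum F x ^ p ∂μ
      ≤ ENNReal.ofReal p * ∑' α, F α * pathSum F (.vertex α) ^ (p - 1) * μ (S α) :=
        lintegral_pathSum_rpow_le h.lt.le F μ
    _ = ENNReal.ofReal p * ∑' α, (F α * (π α : ℝ≥0∞) ^ (1 / p)) *
          (μ (S α) * (π α : ℝ≥0∞) ^ (-(1 / p)) * pathSum F (.vertex α) ^ (p - 1)) := by
        congr 1
        refine tsum_congr fun α => ?_
        have h1 : (π α : ℝ≥0∞) ^ (1 / p) * (π α : ℝ≥0∞) ^ (-(1 / p)) = 1 := by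
          rw [← ENNReal.rpow_add _ _ (by exact_mod_cast hπ α) ENNReal.coe_ne_top, add_neg_cancel,
            ENNReal.rpow_zero]
        calc _ = F α * pathSum F (.vertex α) ^ (p - 1) * μ (S α) * 1 := by rw [mul_one]
          _ = _ := by rw [← h1]; ring
    _ ≤ ENNReal.ofReal p * ((∑' α, F α ^ p * π α) ^ (1 / p) *
          (C * ∫⁻ x, pathSum F x ^ p ∂μ) ^ (1 / r)) := by
        gcongr
        refine (tsum_mul_le_Lp_mul_Lq _ _ h).trans ?_
        gcongr
        · exact h.one_div_nonneg
        · rw [ENNReal.mul_rpow_of_nonneg _ _ h.nonneg, ← ENNReal.rpow_mul,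
            one_div_mul_cancel h.ne_zero, ENNReal.rpow_one]
        · exact h.symm.one_div_nonneg
        · refine le_trans (ENNReal.tsum_le_tsum fun α => le_of_eq ?_)
            (tsum_mul_pathSum_rpow_le h.pos hC F)
          rw [ENNReal.mul_rpow_of_nonneg _ _ h.symm.nonneg,
            ENNReal.mul_rpow_of_nonneg _ _ h.symm.nonneg, ← ENNReal.rpow_mul, ← ENNReal.rpow_mul,
            h.sub_one_mul_conj, hexp]
    _ = _ := by
        rw [ENNReal.mul_rpow_of_nonneg _ _ h.symm.one_div_nonneg]
        ring

lemma SubtreeTesting.hardyInequality {p r : ℝ} (h : p.HolderConjugate r) {π : Edge q → ℝ≥0}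
    (hπ : ∀ α, π α ≠ 0) {μ : Measure (TBar q)} [IsFiniteMeasure μ]
    (hT : SubtreeTesting r π μ) : HardyInequality p π μ := by
  obtain ⟨C, hC⟩ := hT
  have hK : (ENNReal.ofReal p * (C : ℝ≥0∞) ^ (1 / r)) ^ p ≠ ∞ :=
    ENNReal.rpow_ne_top_of_nonneg h.nonneg (ENNReal.mul_ne_top ENNReal.ofReal_ne_top
      (ENNReal.rpow_ne_top_of_nonneg h.symm.one_div_nonneg ENNReal.coe_ne_top))
  refine ⟨((ENNReal.ofReal p * (C : ℝ≥0∞) ^ (1 / r)) ^ p).toNNReal, fun φ => ?_⟩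
  rw [ENNReal.coe_toNNReal hK]
  refine lintegral_pathSum_rpow_le_of_finset (fun α => (φ α : ℝ≥0∞)) h.pos μ fun s => ?_
  refine (lintegral_pathSum_rpow_le_of_subtreeTesting h hπ hC
    (tsum_finset_indicator_ne_top s fun α => ENNReal.coe_ne_top)).trans ?_
  gcongr with α
  rw [ENNReal.coe_mul, ENNReal.coe_rpow_of_nonneg _ h.nonneg]
  gcongr
  · exact h.nonneg
  · exact Set.indicator_le_self' (fun _ _ => zero_le) α

/-- The testing functions are `μ(S(β))^(r-1) π(β)^(1-r)`, cut off to finite subsets of the subtree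
below `α`; for them both sides of the Hardy inequality are multiples of powers of the testing sum. -/
lemma sum_le_of_hardyInequality {p r : ℝ} (h : p.HolderConjugate r) {π : Edge q → ℝ≥0}
    (hπ : ∀ α, π α ≠ 0) {μ : Measure (TBar q)} [IsFiniteMeasure μ] {C : ℝ≥0}
    (hC : ∀ φ : Edge q → ℝ≥0, ∫⁻ x, hardyOp φ x ^ p ∂μ ≤
      C * ∑' α : Edge q, ((φ α ^ p * π α : ℝ≥0) : ℝ≥0∞))
    {α : Edge q} {u : Finset (Edge q)} (hu : ∀ β ∈ u, Below β α) :
    ∑ β ∈ u, μ (S β) ^ r * (π β : ℝ≥0∞) ^ (1 - r) ≤ ((C : ℝ≥0∞) ^ (1 / p)) ^ r * μ (S α) := by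
  classical
  set m : Edge q → ℝ≥0 := fun β => (μ (S β)).toNNReal with hm
  have hmc (β : Edge q) : (m β : ℝ≥0∞) = μ (S β) := ENNReal.coe_toNNReal (measure_ne_top _ _)
  set φ : Edge q → ℝ≥0 := fun β => if β ∈ u then m β ^ (r - 1) * π β ^ (1 - r) else 0 with hφ
  have hφu {β : Edge q} (hβ : β ∈ u) : φ β = m β ^ (r - 1) * π β ^ (1 - r) := if_pos hβ
  have hφ0 {β : Edge q} (hβ : β ∉ u) : φ β = 0 := if_neg hβ
  have hterm (β : Edge q) : μ (S β) ^ r * (π β : ℝ≥0∞) ^ (1 - r) =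
      ((m β ^ r * π β ^ (1 - r) : ℝ≥0) : ℝ≥0∞) := by
    rw [ENNReal.coe_mul, ENNReal.coe_rpow_of_nonneg _ h.symm.nonneg, hmc,
      ENNReal.coe_rpow_of_ne_zero (hπ β)]
  simp_rw [hterm]
  set Q : ℝ≥0∞ := ∑ β ∈ u, ((m β ^ r * π β ^ (1 - r) : ℝ≥0) : ℝ≥0∞) with hQ
  have hQt : Q ≠ ∞ := ENNReal.sum_ne_top.2 fun _ _ => ENNReal.coe_ne_top
  have hnorm : ∑' β, ((φ β ^ p * π β : ℝ≥0) : ℝ≥0∞) = Q := by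
    rw [tsum_eq_sum (s := u) fun β hβ => by
      rw [hφ0 hβ, NNReal.zero_rpow h.ne_zero, zero_mul, ENNReal.coe_zero]]
    refine Finset.sum_congr rfl fun β hβ => ?_
    have h1 : (π β ^ (1 - r)) ^ p * π β = π β ^ (1 - r) := by
      calc (π β ^ (1 - r)) ^ p * π β = π β ^ ((1 - r) * p) * π β ^ (1 : ℝ) := by
            rw [← NNReal.rpow_mul, NNReal.rpow_one]
        _ = _ := by
            rw [← NNReal.rpow_add (hπ β)]
            congr 1
            linear_combination -h.symm.sub_one_mul_conj
    rw [hφu hβ, NNReal.mul_rpow, ← NNReal.rpow_mul, h.symm.sub_one_mul_conj, mul_assoc, h1]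
  have hint : ∫⁻ x, hardyOp φ x ∂μ = Q := by
    change ∫⁻ x, pathSum (fun β => (φ β : ℝ≥0∞)) x ∂μ = Q
    rw [lintegral_pathSum, tsum_eq_sum (s := u) fun β hβ => by
      rw [hφ0 hβ, ENNReal.coe_zero, zero_mul]]
    refine Finset.sum_congr rfl fun β hβ => ?_
    have h1 : m β ^ (r - 1) * m β = m β ^ r := by
      rcases eq_or_ne (m β) 0 with h0 | h0
      · rw [h0, mul_zero, NNReal.zero_rpow h.symm.ne_zero]
      · rw [NNReal.rpow_sub_one h0, div_mul_cancel₀ _ h0]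
    rw [hφu hβ, ← hmc, ← ENNReal.coe_mul, mul_right_comm, h1]
  set g : TBar q → ℝ≥0∞ := (S α).indicator 1 with hg
  have hsupp (x : TBar q) : hardyOp φ x = (hardyOp φ * g) x := by
    rw [Pi.mul_apply]
    by_cases hx : x ∈ S α
    · rw [hg, Set.indicator_of_mem hx, Pi.one_apply, mul_one]
    · rw [hg, Set.indicator_of_notMem hx, mul_zero]
      refine ENNReal.tsum_eq_zero.2 fun β => ?_
      rw [hφ0 fun hβ => hx (mem_path_of_below (hu _ hβ) β.2), ENNReal.coe_zero]
  refine le_of_le_rpow_mul_rpow h.symm hQt ?_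
  calc Q = ∫⁻ x, (hardyOp φ * g) x ∂μ := by
        rw [← hint]; exact lintegral_congr hsupp
    _ ≤ (∫⁻ x, hardyOp φ x ^ p ∂μ) ^ (1 / p) * (∫⁻ x, g x ^ r ∂μ) ^ (1 / r) :=
        ENNReal.lintegral_mul_le_Lp_mul_Lq μ h
          (measurable_pathSum fun β => (φ β : ℝ≥0∞)).aemeasurable
          (measurable_one.indicator (measurableSet_S α)).aemeasurable
    _ ≤ (C * Q) ^ (1 / p) * μ (S α) ^ (1 / r) := by
        gcongr
        · exact h.one_div_nonneg
        · rw [← hnorm]; exact hC φ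
        · exact h.symm.one_div_nonneg
        · rw [← lintegral_indicator_one (measurableSet_S α)]
          refine lintegral_mono fun x => ?_
          by_cases hx : x ∈ S α <;> simp [hg, hx, h.symm.pos]
    _ = _ := by
        rw [ENNReal.mul_rpow_of_nonneg _ _ h.one_div_nonneg]
        ring

lemma HardyInequality.subtreeTesting {p r : ℝ} (h : p.HolderConjugate r) {π : Edge q → ℝ≥0}
    (hπ : ∀ α, π α ≠ 0) {μ : Measure (TBar q)} [IsFiniteMeasure μ]
    (hH : HardyInequality p π μ) : SubtreeTesting r π μ := by
  obtain ⟨C, hC⟩ := hH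
  have hK : ((C : ℝ≥0∞) ^ (1 / p)) ^ r ≠ ∞ :=
    ENNReal.rpow_ne_top_of_nonneg h.symm.nonneg
      (ENNReal.rpow_ne_top_of_nonneg h.one_div_nonneg ENNReal.coe_ne_top)
  refine ⟨(((C : ℝ≥0∞) ^ (1 / p)) ^ r).toNNReal, fun α => ?_⟩
  rw [ENNReal.coe_toNNReal hK, belowSum, ENNReal.tsum_eq_iSup_sum]
  refine iSup_le fun s => ?_
  have := sum_le_of_hardyInequality h hπ hC (α := α) (u := s.map (Function.Embedding.subtype _))
    fun β hβ => by
      obtain ⟨b, -, rfl⟩ := Finset.mem_map.1 hβ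
      exact b.2
  rwa [Finset.sum_map] at this

/-! ### Comparison of sums with suprema -/

/-- Garsia's inequality on the tree: if the part of `∑ a(α) ν(S(α))` below each edge is controlled
by its top term, then in `L^r(ν)` the sums of `a` along geodesics, restricted to a subtree, are
dominated by the suprema. -/
lemma lintegral_pathSum_le_pathSup {p r : ℝ} (h : p.HolderConjugate r) (ν : Measure (TBar q))
    [IsFiniteMeasure ν] {a : Edge q → ℝ≥0∞} (ha : ∀ α, a α ≠ ∞) {c : ℝ≥0∞}
    (hc : ∀ β, belowSum (fun α => a α * ν (S α)) β ≤ c * (a β * ν (S β))) (α₀ : Edge q) :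
    ∫⁻ x, pathSum ({β | Below β α₀}.indicator a) x ^ r ∂ν ≤
      (ENNReal.ofReal r * c) ^ r * ∫⁻ x, pathSup ({β | Below β α₀}.indicator a) x ^ r ∂ν := by
  have hr1 : 0 < r - 1 := h.symm.sub_one_pos
  refine lintegral_pathSum_rpow_le_of_finset _ h.symm.pos ν fun s => ?_
  set A := {β | Below β α₀}.indicator a with hA
  set F := (s : Set (Edge q)).indicator A with hF
  have hAa : A ≤ a := Set.indicator_le_self' fun _ _ => zero_le
  have hFA : F ≤ A := Set.indicator_le_self' fun _ _ => zero_le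
  refine le_of_le_rpow_mul_rpow h.symm (lintegral_pathSum_rpow_ne_top
    (tsum_finset_indicator_ne_top s fun α => ne_top_of_le_ne_top (ha α) (hAa α))
    h.symm.nonneg ν) ?_
  set D := increment F (r - 1) with hD
  have hDA (β : Edge q) : D β * a β = D β * A β := by
    by_cases hβ : Below β α₀
    · rw [hA, Set.indicator_of_mem (show β ∈ {β | Below β α₀} from hβ)]
    · -- All edges of the geodesic to `β` lie outside the subtree below `α₀`.
      have h0 : pathSum F (.vertex β) = 0 := ENNReal.tsum_eq_zero.2 fun δ => by
        have hδ : A δ = 0 :=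
          Set.indicator_of_notMem (s := {β | Below β α₀})
            (fun hδ => hβ (mem_path_of_below hδ δ.2)) _
        exact le_antisymm ((hFA δ).trans hδ.le) zero_le
      simp [hD, increment, h0, hr1]
  calc ∫⁻ x, pathSum F x ^ r ∂ν
      ≤ ENNReal.ofReal r * ∑' α, F α * pathSum F (.vertex α) ^ (r - 1) * ν (S α) :=
        lintegral_pathSum_rpow_le h.symm.lt.le F ν
    _ = ENNReal.ofReal r * ∑' β, D β * belowSum (fun α => F α * ν (S α)) β := by
        rw [← tsum_mul_pathSum]
        simp_rw [hD, pathSum_increment F hr1, mul_right_comm]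
    _ ≤ ENNReal.ofReal r * ∑' β, c * (D β * A β * ν (S β)) := by
        refine mul_le_mul_right (ENNReal.tsum_le_tsum fun β => ?_) _
        calc D β * belowSum (fun α => F α * ν (S α)) β
            ≤ D β * (c * (a β * ν (S β))) := by
              gcongr
              refine le_trans (ENNReal.tsum_le_tsum fun α => ?_) (hc β)
              exact mul_le_mul_left ((hFA α).trans (hAa α)) _
          _ = c * (D β * a β * ν (S β)) := by ring
          _ = _ := by rw [hDA]
    _ = ENNReal.ofReal r * c * ∫⁻ x, pathSum (fun β => D β * A β) x ∂ν := by
        rw [ENNReal.tsum_mul_left, lintegral_pathSum, mul_assoc]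
    _ ≤ ENNReal.ofReal r * c * ∫⁻ x, (pathSup A * fun x => pathSum F x ^ (r - 1)) x ∂ν := by
        gcongr with x
        rw [Pi.mul_apply, ← pathSum_increment F hr1, ← pathSum_const_mul]
        refine pathSum_mono fun β hβ => ?_
        rw [mul_comm]
        gcongr
        exact le_pathSup A hβ
    _ ≤ ENNReal.ofReal r * c * ((∫⁻ x, pathSup A x ^ r ∂ν) ^ (1 / r) *
          (∫⁻ x, (pathSum F x ^ (r - 1)) ^ p ∂ν) ^ (1 / p)) := by
        gcongr
        exact ENNReal.lintegral_mul_le_Lp_mul_Lq ν h.symm (measurable_pathSup _).aemeasurable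
          ((measurable_pathSum _).pow_const _).aemeasurable
    _ = _ := by
        simp_rw [← ENNReal.rpow_mul, h.symm.sub_one_mul_conj]
        ring

lemma pathSup_rpow_le (F : Edge q → ℝ≥0∞) {r : ℝ} (hr : 0 < r) (x : TBar q) :
    pathSup F x ^ r ≤ pathSum (fun α => F α ^ r) x := by
  rw [pathSup, iSup_rpow hr]
  exact iSup_le fun α => le_pathSum (fun α => F α ^ r) α.2

lemma pathSum_rpow_le_rpow (F : Edge q → ℝ≥0∞) {r : ℝ} (hr : 1 ≤ r) (x : TBar q) :
    pathSum (fun α => F α ^ r) x ≤ pathSum F x ^ r := by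
  have hr1 : 0 ≤ r - 1 := sub_nonneg.2 hr
  calc pathSum (fun α => F α ^ r) x
      ≤ pathSum (fun α => pathSum F x ^ (r - 1) * F α) x := by
        refine pathSum_mono fun α hα => ?_
        rw [← sub_add_cancel r 1, ENNReal.rpow_add_of_nonneg _ _ hr1 zero_le_one,
          ENNReal.rpow_one, add_sub_cancel_right]
        gcongr
        exact le_pathSum F hα
    _ = pathSum F x ^ r := by
        rw [pathSum_const_mul]
        nth_rewrite 2 [← ENNReal.rpow_one (pathSum F x)]
        rw [← ENNReal.rpow_add_of_nonneg _ _ hr1 zero_le_one, sub_add_cancel]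

/-! ### Lebesgue measure on the boundary -/

lemma size_ne_zero [NeZero q] (α : Edge q) : size α ≠ 0 :=
  inv_ne_zero (pow_ne_zero _ (NeZero.ne _))

lemma size_rpow (t : ℝ) (α : Edge q) : size α ^ t = (((q : ℝ≥0)⁻¹) ^ t) ^ α.length := by
  rw [size, ← inv_pow, ← NNReal.rpow_natCast, ← NNReal.rpow_natCast, ← NNReal.rpow_mul,
    ← NNReal.rpow_mul, mul_comm]

lemma isOpen_bdryS (α : Edge q) : IsOpen (bdryS α) := by
  have h : bdryS α = ⋂ i : Fin α.length, (fun x : Boundary q => x i) ⁻¹' {α.get i} := by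
    ext x; simp [bdryS]
  rw [h]
  exact isOpen_iInter_of_finite fun i => (isOpen_discrete _).preimage (continuous_apply _)

lemma measurable_bdry : Measurable (TBar.bdry : Boundary q → TBar q) := by
  refine Continuous.measurable (continuous_generateFrom_iff.2 ?_)
  rintro _ ((⟨α, rfl⟩ | ⟨w, rfl⟩) | rfl)
  · exact isOpen_bdryS α
  · convert isOpen_empty
    ext x; simp
  · convert isOpen_empty
    ext x; simp

/-- Lebesgue measure on the boundary, as a measure on `T ∪ ∂T`. -/
def bdryMeasure (q : ℕ) [NeZero q] : Measure (TBar q) := (lebesgue q).map .bdry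

lemma bdryMeasure_S [NeZero q] (α : Edge q) : bdryMeasure q (S α) = size α := by
  rw [bdryMeasure, Measure.map_apply measurable_bdry (measurableSet_S α), ← lebesgue_bdryS]
  rfl

instance [NeZero q] : IsFiniteMeasure (bdryMeasure q) := by
  refine ⟨?_⟩
  rw [bdryMeasure, Measure.map_apply measurable_bdry .univ]
  have h : (TBar.bdry ⁻¹' Set.univ : Set (Boundary q)) = bdryS [] := by
    ext x; simp [bdryS]
  rw [h, lebesgue_bdryS]
  exact ENNReal.coe_lt_top

lemma tsum_edgesBetween (F : Edge q → ℝ≥0∞) (α : Edge q) (x : Boundary q) :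
    ∑' β : edgesBetween α x, F β = pathSum ({β | Below β α}.indicator F) (.bdry x) := by
  have h : edgesBetween α x = path (.bdry x) ∩ {β | Below β α} := Set.inter_comm _ _
  rw [pathSum, tsum_subtype (path (.bdry x)), tsum_subtype (edgesBetween α x) F, h,
    Set.indicator_indicator]

lemma iSup_edgesBetween (F : Edge q → ℝ≥0∞) (α : Edge q) (x : Boundary q) :
    ⨆ β : edgesBetween α x, F β = pathSup ({β | Below β α}.indicator F) (.bdry x) := by
  refine le_antisymm (iSup_le fun β => ?_) (iSup_le fun β => ?_)
  · have := le_pathSup ({β | Below β α}.indicator F) (x := .bdry x) β.2.2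
    rwa [Set.indicator_of_mem (show (β : Edge q) ∈ {β | Below β α} from β.2.1)] at this
  · by_cases hβ : Below (β : Edge q) α
    · rw [Set.indicator_of_mem (show (β : Edge q) ∈ {β | Below β α} from hβ)]
      exact le_iSup (fun β : edgesBetween α x => F β) ⟨β, hβ, β.2⟩
    · rw [Set.indicator_of_notMem (show (β : Edge q) ∉ {β | Below β α} from hβ)]
      exact zero_le

lemma edgesBetween_eq_empty {α : Edge q} {x : Boundary q} (hx : x ∉ bdryS α) :
    edgesBetween α x = ∅ :=
  Set.eq_empty_of_forall_notMem fun _ hβ => hx (mem_path_of_below (x := .bdry x) hβ.1 hβ.2)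

lemma setLIntegral_bdryS_eq [NeZero q] {α : Edge q} {f : Boundary q → ℝ≥0∞} {g : TBar q → ℝ≥0∞}
    (hg : Measurable g) (hfg : ∀ x, f x = g (.bdry x)) (hf : ∀ x ∉ bdryS α, f x = 0) :
    ∫⁻ x in bdryS α, f x ∂(lebesgue q) = ∫⁻ x, g x ∂(bdryMeasure q) := by
  rw [bdryMeasure, lintegral_map hg measurable_bdry,
    ← lintegral_indicator (isOpen_bdryS α).measurableSet]
  refine lintegral_congr fun x => ?_
  rw [← hfg]
  by_cases hx : x ∈ bdryS α
  · rw [Set.indicator_of_mem hx]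
  · rw [Set.indicator_of_notMem hx, hf x hx]

lemma setLIntegral_tsum_edgesBetween [NeZero q] (F : Edge q → ℝ≥0∞) {r : ℝ} (hr : 0 < r)
    (α : Edge q) :
    ∫⁻ x in bdryS α, (∑' β : edgesBetween α x, F β) ^ r ∂(lebesgue q) =
      ∫⁻ x, pathSum ({β | Below β α}.indicator F) x ^ r ∂(bdryMeasure q) := by
  refine setLIntegral_bdryS_eq ((measurable_pathSum _).pow_const r)
    (fun x => by rw [tsum_edgesBetween]) fun x hx => ?_
  rw [edgesBetween_eq_empty hx, tsum_empty, ENNReal.zero_rpow_of_pos hr]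

lemma setLIntegral_iSup_edgesBetween [NeZero q] (F : Edge q → ℝ≥0∞) {r : ℝ} (hr : 0 < r)
    (α : Edge q) :
    ∫⁻ x in bdryS α, (⨆ β : edgesBetween α x, F β) ^ r ∂(lebesgue q) =
      ∫⁻ x, pathSup ({β | Below β α}.indicator F) x ^ r ∂(bdryMeasure q) := by
  refine setLIntegral_bdryS_eq ((measurable_pathSup _).pow_const r)
    (fun x => by rw [iSup_edgesBetween]) fun x hx => ?_
  rw [edgesBetween_eq_empty hx, iSup_of_empty, bot_eq_zero, ENNReal.zero_rpow_of_pos hr]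

/-- A supremum of quotients is finite if and only if the numerators are bounded by a multiple of
the denominators. Where `M i = 0`, finiteness of `∞ * J i` forces `J i = 0`. -/
lemma iSup_inv_mul_lt_top_iff {ι : Type*} {J M : ι → ℝ≥0∞} (hM : ∀ i, M i ≠ ∞) :
    ⨆ i, (M i)⁻¹ * J i < ∞ ↔ ∃ C : ℝ≥0, ∀ i, J i ≤ C * M i := by
  refine ⟨fun h => ⟨(⨆ i, (M i)⁻¹ * J i).toNNReal, fun i => ?_⟩, fun ⟨C, hC⟩ => ?_⟩
  · rw [ENNReal.coe_toNNReal h.ne]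
    have hi : (M i)⁻¹ * J i ≤ ⨆ i, (M i)⁻¹ * J i := le_iSup (fun i => (M i)⁻¹ * J i) i
    rcases eq_or_ne (M i) 0 with h0 | h0
    · have hJ : J i = 0 := by
        by_contra hJ
        rw [h0, ENNReal.inv_zero, ENNReal.top_mul hJ] at hi
        exact (hi.trans_lt h).false
      simp [hJ]
    · rw [← ENNReal.div_le_iff h0 (hM i), ENNReal.div_eq_inv_mul]
      exact hi
  · refine (iSup_le fun i => ?_).trans_lt (ENNReal.coe_lt_top (r := C))
    rw [← ENNReal.div_eq_inv_mul]
    exact ENNReal.div_le_of_le_mul (hC i)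

/-! ### The two testing conditions -/

/-- The quotient `μ(S(α)) / |α|^s` in the testing conditions. -/
def density (s : ℝ) (μ : Measure (TBar q)) (α : Edge q) : ℝ≥0∞ :=
  μ (S α) / ((size α ^ s : ℝ≥0) : ℝ≥0∞)

lemma size_rpow_ne_zero [NeZero q] (s : ℝ) (α : Edge q) :
    ((size α ^ s : ℝ≥0) : ℝ≥0∞) ≠ 0 := by
  exact_mod_cast (NNReal.rpow_pos (pos_of_ne_zero (size_ne_zero α))).ne'

lemma density_ne_top [NeZero q] (s : ℝ) (μ : Measure (TBar q)) [IsFiniteMeasure μ] (α : Edge q) :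
    density s μ α ≠ ∞ :=
  ENNReal.div_ne_top (measure_ne_top _ _) (size_rpow_ne_zero s α)

lemma density_mul_size [NeZero q] (s : ℝ) (μ : Measure (TBar q)) (α : Edge q) :
    density s μ α * size α = ((size α ^ (1 - s) : ℝ≥0) : ℝ≥0∞) * μ (S α) := by
  have h : size α ^ (1 - s) = (size α ^ s)⁻¹ * size α := by
    rw [NNReal.rpow_sub (size_ne_zero α), NNReal.rpow_one, div_eq_inv_mul]
  rw [density, h, ENNReal.coe_mul, ENNReal.coe_inv (by exact_mod_cast size_rpow_ne_zero s α),
    ENNReal.div_eq_inv_mul]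
  ring

lemma weight_ne_zero [NeZero q] (p s : ℝ) (α : Edge q) : weight p s α ≠ 0 :=
  (NNReal.rpow_pos (pos_of_ne_zero (size_ne_zero α))).ne'

lemma density_rpow_mul_size [NeZero q] {p r : ℝ} (h : p.HolderConjugate r) (s : ℝ)
    (μ : Measure (TBar q)) (α : Edge q) :
    density s μ α ^ r * size α = μ (S α) ^ r * (weight p s α : ℝ≥0∞) ^ (1 - r) := by
  have h1r : 1 - r ≠ 0 := by have := h.symm.lt; linarith
  have hw : weight p s α ^ (1 - r) = (size α ^ s)⁻¹ ^ r * size α := by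
    rw [weight, h.conjExponent_eq, ← NNReal.rpow_mul, div_mul_cancel₀ _ h1r,
      ← NNReal.rpow_neg, ← NNReal.rpow_mul]
    nth_rewrite 3 [← NNReal.rpow_one (size α)]
    rw [← NNReal.rpow_add (size_ne_zero α)]
    congr 1
    ring
  rw [← ENNReal.coe_rpow_of_ne_zero (weight_ne_zero p s α), hw, ENNReal.coe_mul, density, div_eq_mul_inv,
    ENNReal.mul_rpow_of_nonneg _ _ h.symm.nonneg, ENNReal.coe_rpow_of_nonneg _ h.symm.nonneg,
    ENNReal.coe_inv (by exact_mod_cast size_rpow_ne_zero s α), mul_assoc]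

/-- The sum of `|α|^(1-s) μ(S(α))` over the edges below `β` is the integral over `S(β)` of a sum of
`|α|^(1-s)` along geodesics, which is dominated by a geometric series starting at `|β|^(1-s)`. The
constant is finite for `q ≥ 2` and `s < 1`, see `inv_one_sub_ne_top`. -/
lemma belowSum_density_le [NeZero q] (s : ℝ) (μ : Measure (TBar q)) (β : Edge q) :
    belowSum (fun α => density s μ α * size α) β ≤
      (1 - ((((q : ℝ≥0)⁻¹) ^ (1 - s) : ℝ≥0) : ℝ≥0∞))⁻¹ * (density s μ β * size β) := by
  set θ : ℝ≥0 := ((q : ℝ≥0)⁻¹) ^ (1 - s) with hθ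
  set w : Edge q → ℝ≥0∞ := fun α => ((size α ^ (1 - s) : ℝ≥0) : ℝ≥0∞) with hw
  have hwθ (α : Edge q) : w α = (θ : ℝ≥0∞) ^ α.length := by
    rw [hw, hθ, ← ENNReal.coe_pow, ← size_rpow]
  have hpt (x : TBar q) : pathSum ({α | Below α β}.indicator w) x ≤
      (S β).indicator (fun _ => (1 - (θ : ℝ≥0∞))⁻¹ * w β) x := by
    have heq : pathSum ({α | Below α β}.indicator w) x =
        ∑' α : ↥(path x ∩ {α | Below α β}), w α := by
      rw [pathSum, tsum_subtype (path x), tsum_subtype (path x ∩ {α | Below α β}) w,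
        Set.indicator_indicator]
    by_cases hx : x ∈ S β
    · rw [Set.indicator_of_mem hx, heq, ← ENNReal.tsum_geometric, ← ENNReal.tsum_mul_right]
      have hlen (α : ↥(path x ∩ {α | Below α β})) : β.length ≤ (α : Edge q).length :=
        List.IsPrefix.length_le α.2.2
      have hinj : Function.Injective fun α : ↥(path x ∩ {α | Below α β}) =>
          (α : Edge q).length - β.length := fun α α' h => by
        have h1 := hlen α
        have h2 := hlen α'
        exact Subtype.ext (eq_of_mem_path α.2.1 α'.2.1 (by simp only at h; omega))
      refine le_trans (ENNReal.tsum_le_tsum fun α => le_of_eq ?_)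
        (ENNReal.tsum_comp_le_tsum_of_injective hinj fun n => (θ : ℝ≥0∞) ^ n * w β)
      rw [hwθ, hwθ, ← pow_add, Nat.sub_add_cancel (hlen α)]
    · rw [Set.indicator_of_notMem hx, heq]
      refine (ENNReal.tsum_eq_zero.2 fun α => ?_).le
      exact (hx (mem_path_of_below α.2.2 α.2.1)).elim
  calc belowSum (fun α => density s μ α * size α) β
      = ∫⁻ x, pathSum ({α | Below α β}.indicator w) x ∂μ := by
        simp_rw [density_mul_size]
        rw [lintegral_pathSum, belowSum,
          tsum_subtype {α | Below α β} (fun α => w α * μ (S α))]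
        refine tsum_congr fun α => ?_
        rw [Set.indicator_mul_left]
    _ ≤ ∫⁻ x, (S β).indicator (fun _ => (1 - (θ : ℝ≥0∞))⁻¹ * w β) x ∂μ := lintegral_mono hpt
    _ = _ := by
        rw [lintegral_indicator_const (measurableSet_S β), density_mul_size, mul_assoc]

lemma inv_one_sub_ne_top (hq : 2 ≤ q) {s : ℝ} (hs : s < 1) :
    (1 - ((((q : ℝ≥0)⁻¹) ^ (1 - s) : ℝ≥0) : ℝ≥0∞))⁻¹ ≠ ∞ := by
  rw [ENNReal.inv_ne_top, Ne, tsub_eq_zero_iff_le, not_le]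
  have h : (q : ℝ≥0)⁻¹ < 1 := inv_lt_one_of_one_lt₀ (by exact_mod_cast hq)
  exact_mod_cast NNReal.rpow_lt_one h (sub_pos.2 hs)

lemma sumTesting_iff [NeZero q] {r : ℝ} (hr : 0 < r) (s : ℝ) (μ : Measure (TBar q))
    [IsFiniteMeasure μ] :
    SumTesting r s μ ↔ ∃ C : ℝ≥0, ∀ α, ∫⁻ x,
      pathSum ({β | Below β α}.indicator (density s μ)) x ^ r ∂(bdryMeasure q) ≤ C * μ (S α) := by
  rw [SumTesting, iSup_inv_mul_lt_top_iff fun α => measure_ne_top μ (S α)]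
  simp_rw [← setLIntegral_tsum_edgesBetween _ hr]
  rfl

lemma supTesting_iff [NeZero q] {r : ℝ} (hr : 0 < r) (s : ℝ) (μ : Measure (TBar q))
    [IsFiniteMeasure μ] :
    SupTesting r s μ ↔ ∃ C : ℝ≥0, ∀ α, ∫⁻ x,
      pathSup ({β | Below β α}.indicator (density s μ)) x ^ r ∂(bdryMeasure q) ≤ C * μ (S α) := by
  rw [SupTesting, iSup_inv_mul_lt_top_iff fun α => measure_ne_top μ (S α)]
  simp_rw [← setLIntegral_iSup_edgesBetween _ hr]
  rfl

/-- Testing over subtrees for the weight `π` is the variant of the conditions of the theorem in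
which the sum over a geodesic is replaced by an `ℓ^r` norm. -/
lemma belowSum_weight_eq [NeZero q] {p r : ℝ} (h : p.HolderConjugate r) (s : ℝ)
    (μ : Measure (TBar q)) (α : Edge q) :
    belowSum (fun β => μ (S β) ^ r * (weight p s β : ℝ≥0∞) ^ (1 - r)) α =
      ∫⁻ x, pathSum (fun β => {β | Below β α}.indicator (density s μ) β ^ r) x
        ∂(bdryMeasure q) := by
  simp_rw [lintegral_pathSum, bdryMeasure_S, ← density_rpow_mul_size h]
  rw [belowSum, tsum_subtype {β | Below β α} (fun β => density s μ β ^ r * (size β : ℝ≥0∞))]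
  refine tsum_congr fun β => ?_
  by_cases hβ : β ∈ {β | Below β α}
  · rw [Set.indicator_of_mem hβ, Set.indicator_of_mem hβ]
  · rw [Set.indicator_of_notMem hβ, Set.indicator_of_notMem hβ,
      ENNReal.zero_rpow_of_pos h.symm.pos, zero_mul]

lemma SumTesting.subtreeTesting [NeZero q] {p r : ℝ} (h : p.HolderConjugate r) {s : ℝ}
    {μ : Measure (TBar q)} [IsFiniteMeasure μ] (hT : SumTesting r s μ) :
    SubtreeTesting r (weight p s) μ := by
  obtain ⟨C, hC⟩ := (sumTesting_iff h.symm.pos s μ).1 hT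
  refine ⟨C, fun α => ?_⟩
  rw [belowSum_weight_eq h]
  exact (lintegral_mono fun x => pathSum_rpow_le_rpow _ h.symm.lt.le x).trans (hC α)

lemma SubtreeTesting.supTesting [NeZero q] {p r : ℝ} (h : p.HolderConjugate r) {s : ℝ}
    {μ : Measure (TBar q)} [IsFiniteMeasure μ] (hT : SubtreeTesting r (weight p s) μ) :
    SupTesting r s μ := by
  obtain ⟨C, hC⟩ := hT
  refine (supTesting_iff h.symm.pos s μ).2 ⟨C, fun α => ?_⟩
  refine (lintegral_mono fun x => pathSup_rpow_le _ h.symm.pos x).trans ?_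
  rw [← belowSum_weight_eq h]
  exact hC α

lemma SupTesting.sumTesting [q.AtLeastTwo] {p r : ℝ} (h : p.HolderConjugate r) {s : ℝ}
    (hs : s < 1) {μ : Measure (TBar q)} [IsFiniteMeasure μ] (hT : SupTesting r s μ) :
    SumTesting r s μ := by
  obtain ⟨C, hC⟩ := (supTesting_iff h.symm.pos s μ).1 hT
  set c : ℝ≥0∞ := (1 - ((((q : ℝ≥0)⁻¹) ^ (1 - s) : ℝ≥0) : ℝ≥0∞))⁻¹ with hc
  have hK : (ENNReal.ofReal r * c) ^ r ≠ ∞ :=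
    ENNReal.rpow_ne_top_of_nonneg h.symm.nonneg
      (ENNReal.mul_ne_top ENNReal.ofReal_ne_top (inv_one_sub_ne_top Nat.AtLeastTwo.prop hs))
  refine (sumTesting_iff h.symm.pos s μ).2
    ⟨((ENNReal.ofReal r * c) ^ r).toNNReal * C, fun α => ?_⟩
  rw [ENNReal.coe_mul, ENNReal.coe_toNNReal hK, mul_assoc]
  refine (lintegral_pathSum_le_pathSup h (bdryMeasure q) (density_ne_top s μ) (fun β => ?_)
    α).trans (mul_le_mul_right (hC α) _)
  simp_rw [bdryMeasure_S]
  exact belowSum_density_le s μ β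

end HardyTree

end

open HardyTree in
theorem theorem1p4 (q : ℕ) [q.AtLeastTwo] (p s : ℝ) (hp : 1 < p) (hs0 : 0 < s) (hs1 : s < 1)
    (μ : Measure (TBar q)) [IsFiniteMeasure μ] :
    (HardyInequality p (weight p s) μ ↔ SumTesting p.conjExponent s μ) ∧
      (HardyInequality p (weight p s) μ ↔ SupTesting p.conjExponent s μ) := by
  have h : p.HolderConjugate p.conjExponent := Real.HolderConjugate.conjExponent hp
  have h1 : HardyInequality p (weight p s) μ → SupTesting p.conjExponent s μ :=
    fun hH => (hH.subtreeTesting h (weight_ne_zero p s)).supTesting h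
  have h2 : SupTesting p.conjExponent s μ → SumTesting p.conjExponent s μ :=
    fun hT => hT.sumTesting h hs1
  have h3 : SumTesting p.conjExponent s μ → HardyInequality p (weight p s) μ :=
    fun hT => (hT.subtreeTesting h).hardyInequality h (weight_ne_zero p s)
  exact ⟨⟨fun hH => h2 (h1 hH), h3⟩, ⟨h1, fun hT => h3 (h2 hT)⟩⟩
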